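/- Let $(S,\psi_S)$ be a complete separable metric space with its Borel $\sigma$-algebra, and let $V:S\to\mathbb{R}$ be lower semi-continuous with $\inf_S V>0$. Put $\varpi_V(x,y)=V(x)+V(y)$, $\varphi_0(x,y)=1_{x\neq y}$, $\varphi_V=\varphi_0\,\varpi_V$, and let $\mathcal{P}_V(S)$ be the set of Borel probability measures $\mu$ on $S$ with $\mu(V)<\infty$. A semi-distance is a lower semi-continuous function $\phi:S\times S\to[0,\infty)$ with $\phi(x,y)=0$ if and only if $x=y$; it is a $V$-semi-distance if moreover $\sup\phi/\varpi_V<\infty$. For a semi-distance $\phi$ let $$D_\phi(\mu_1,\mu_2)=\inf_{\pi}\int\phi\,d\pi\in[0,\infty],$$ where the infimum is over all couplings $\pi$ of the probability measures $\mu_1$ and $\mu_2$. For a Markov kernel $Q$ on $S$ define the $\phi$-Dobrushin coefficient $$\beta_\phi(Q)=\sup\Big\{\frac{D_\phi(\mu_1Q,\mu_2Q)}{D_\phi(\mu_1,\mu_2)}\;:\;\mu_1,\mu_2\in\mathcal{P}_V(S),\ D_\phi(\mu_1,\mu_2)>0\Big\}\in[0,\infty].$$ For semi-distances $\phi,\kappa$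 and $\iota\in[1/2,1)$ put $\phi_V=\phi+\varphi_V$ and $\kappa_{\iota,V}=\kappa^{\iota}\,\varphi_V^{1-\iota}$. Let $P$ be a Markov kernel on $S$, with $P_0=I$ and $P_n=P_{n-1}P$ for $n\ge1$, that satisfies (H1) there exist $\epsilon\in(0,1)$ and $c\ge0$ with $P(V)\le\epsilon V+c$. For a $V$-semi-distance $\kappa$ consider the condition (H2) there exist $r_0>0$ and a map $\alpha:[r_0,\infty)\to(0,1)$ such that, for all $r\ge r_0$ and all $x,y\in S$, $\varpi_V(x,y)\le r$ implies $D_\kappa(\delta_xP,\delta_yP)\le(1-\alpha(r))\,\kappa(x,y)$. Then the following hold. 1. If (H2) holds for some $V$-semi-distance $\kappa$, then for every $\iota\in[1/2,1)$ there exist $c\ge0$ and $\lambda\in(0,1)$ such that $\beta_{\kappa_{\iota,V}}(P_n)\le c\,\lambda^n$ for all $n\ge0$. 2. If (H2) holds for $\kappa=\varphi_0$, then there exist $c\ge0$ and $\lambda\in(0,1)$ such that $\beta_{\varphi_V}(P_n)\le c\,\lambda^n$ for all $n\ge0$. Moreover, for every $V$-semi-distance $\phi$ there exist $c\ge0$ and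 $\lambda\in(0,1)$ such that $\beta_{\phi_V}(P_n)\le c\,\lambda^n$ for all $n\ge0$. -/

import Mathlib

open MeasureTheory ProbabilityTheory
open scoped ENNReal

namespace KantorovichContraction

noncomputable section

section Costs

variable {S : Type*}

/-- The sum `ϖ_V(x, y) = V x + V y`. -/
def varpi (V : S → ℝ) (z : S × S) : ℝ := V z.1 + V z.2

/-- The discrete metric `φ₀(x, y) = 1` if `x ≠ y` and `0` otherwise. -/
def discreteCost (z : S × S) : ℝ := (Set.diagonal S)ᶜ.indicator (fun _ => (1 : ℝ)) z

/-- The weighted discrete metric `φ_V(x, y) = φ₀(x, y) (V x + V y)`. -/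
def weightedDiscreteCost (V : S → ℝ) (z : S × S) : ℝ := discreteCost z * varpi V z

/-- The cost `κ_{ι,V} = κ ^ ι * φ_V ^ (1 - ι)`. -/
def interpolatedCost (V : S → ℝ) (κ : S × S → ℝ) (ι : ℝ) (z : S × S) : ℝ :=
  κ z ^ ι * weightedDiscreteCost V z ^ (1 - ι)

/-- The cost `φ + φ_V`. -/
def augmentedCost (V : S → ℝ) (φ : S × S → ℝ) (z : S × S) : ℝ :=
  φ z + weightedDiscreteCost V z

end Costs

section SemiDistances

variable {S : Type*} [TopologicalSpace S]

/-- A weight function: lower semi-continuous and bounded below away from zero. -/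
structure IsWeight (V : S → ℝ) : Prop where
  lowerSemicontinuous : LowerSemicontinuous V
  bounded_away : ∃ δ : ℝ, 0 < δ ∧ ∀ x, δ ≤ V x

/-- Semi-distances: non-negative lower semi-continuous functions on `S × S` vanishing exactly
on the diagonal (neither symmetry nor a triangle inequality is required). -/
structure IsSemiDistance (φ : S × S → ℝ) : Prop where
  nonneg : ∀ x y, 0 ≤ φ (x, y)
  eq_zero_iff : ∀ x y, φ (x, y) = 0 ↔ x = y
  lowerSemicontinuous : LowerSemicontinuous φ

/-- `V`-semi-distances: semi-distances `φ` for which `φ / ϖ_V` is bounded. -/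
structure IsVSemiDistance (V : S → ℝ) (φ : S × S → ℝ) : Prop extends IsSemiDistance φ where
  bounded : ∃ C : ℝ, ∀ z, |φ z / varpi V z| ≤ C

end SemiDistances

section Transport

variable {S : Type*} [MeasurableSpace S]

/-- The set of couplings of `μ₁` and `μ₂`. -/
def couplings (μ₁ μ₂ : Measure S) : Set (Measure (S × S)) :=
  {π | π.map Prod.fst = μ₁ ∧ π.map Prod.snd = μ₂}

/-- The Kantorovich semi-distance `D_φ(μ₁, μ₂) = inf_π π(φ)`, with values in `[0, ∞]`
(for a non-negative cost `φ`). -/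
def kantorovich (φ : S × S → ℝ) (μ₁ μ₂ : Measure S) : ℝ≥0∞ :=
  ⨅ π ∈ couplings μ₁ μ₂, ∫⁻ z, ENNReal.ofReal (φ z) ∂π

/-- The set `𝒫_V(S)` of probability measures `μ` with `μ(V) < ∞` (for a non-negative `V`). -/
def probV (V : S → ℝ) : Set (Measure S) :=
  {μ | IsProbabilityMeasure μ ∧ ∫⁻ x, ENNReal.ofReal (V x) ∂μ < ∞}

/-- The `(ψ, φ)`-Dobrushin contraction coefficient of a kernel `P`, with values in `[0, ∞]`: the
supremum of `D_φ(μ₁ P, μ₂ P) / D_ψ(μ₁, μ₂)` over all `μ₁, μ₂ ∈ 𝒫_V(S)` with `D_ψ(μ₁, μ₂) > 0`. -/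
def dobrushin₂ (V : S → ℝ) (ψ φ : S × S → ℝ) (P : Kernel S S) : ℝ≥0∞ :=
  ⨆ (μ₁ ∈ probV V) (μ₂ ∈ probV V) (_ : 0 < kantorovich ψ μ₁ μ₂),
    kantorovich φ (μ₁.bind P) (μ₂.bind P) / kantorovich ψ μ₁ μ₂

/-- The `φ`-Dobrushin contraction coefficient `β_φ(P) = β_{φ,φ}(P)`. -/
def dobrushin (V : S → ℝ) (φ : S × S → ℝ) (P : Kernel S S) : ℝ≥0∞ :=
  dobrushin₂ V φ φ P

/-- The geometric drift condition `P(V) ≤ ε V + c`; the integral is taken in `[0, ∞]`, so that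
the integrability of `V` under each `P(x, ·)` is part of the condition. -/
def DriftCondition (V : S → ℝ) (P : Kernel S S) : Prop :=
  ∃ ε c : ℝ, 0 < ε ∧ ε < 1 ∧ 0 ≤ c ∧
    ∀ x, ∫⁻ y, ENNReal.ofReal (V y) ∂(P x) ≤ ENNReal.ofReal (ε * V x + c)

/-- The local contraction condition for the cost `κ`: for all `r ≥ r₀`, whenever
`V x + V y ≤ r`, one has `D_κ(δ_x P, δ_y P) ≤ (1 - α(r)) κ(x, y)`. Here `δ_x P = P(x, ·)`. -/
def LocalContraction (V : S → ℝ) (κ : S × S → ℝ) (P : Kernel S S) : Prop :=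
  ∃ (r₀ : ℝ) (α : ℝ → ℝ), 0 < r₀ ∧ (∀ r, r₀ ≤ r → 0 < α r ∧ α r < 1) ∧
    ∀ r, r₀ ≤ r → ∀ x y, varpi V (x, y) ≤ r →
      kantorovich κ (P x) (P y) ≤ ENNReal.ofReal ((1 - α r) * κ (x, y))

/-- `β_φ(P_n) ≤ c λ ^ n` for all `n ≥ 0`, for some constants `c ≥ 0` and `λ ∈ (0, 1)`.
The power `P ^ n` for the composition of kernels (with `P ^ 0 = Kernel.id`) is `P_n`. -/
def ExponentialDecay (V : S → ℝ) (φ : S × S → ℝ) (P : Kernel S S) : Prop :=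
  ∃ c lam : ℝ, 0 ≤ c ∧ 0 < lam ∧ lam < 1 ∧
    ∀ n : ℕ, dobrushin V φ (P ^ n) ≤ ENNReal.ofReal (c * lam ^ n)

end Transport

end

end KantorovichContraction

/-! Exponential decay follows from a one-step contraction, on Dirac masses, of an equivalent cost:
replace `V` by `W = V + b`. Since `V ≥ δ > 0` the costs built from `V` and `W` are comparable, so a
bound `λ ^ n` for one gives `C λ ^ n` for the other (`exponentialDecay_of_contraction`). Pairs are
split at a level `r` of `ϖ_V`. Below `r`, local contraction shrinks `κ` by some `s < 1`, and a large
`b` makes the drift constant negligible. Above `r`, `κ` does not expand and the drift shrinks `ϖ_W`.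
Hölder's inequality combines both effects for the interpolated cost; in the discrete case `φ_W = φ_V
+ 2bφ₀` and the two terms are estimated additively. Passing from Dirac masses to general measures
needs joint convexity of the transport cost (`exists_coupling_bind`). Measurable selection of
couplings is avoided: couplings are chosen arbitrarily, averaged along an i.i.d. sample, and a weak
limit is extracted by Prokhorov's theorem. -/

namespace KantorovichContraction

open Filter Topology

/-! ### Empirical averages and the strong law of large numbers. -/

section Empirical

variable {E F : Type*} [MeasurableSpace E] [MeasurableSpace F]

/-- The average of the first `n + 1` terms of a sequence of measures. -/
noncomputable def averageMeasure (m : ℕ → Measure E) (n : ℕ) : Measure E :=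
  ((n + 1 : ℕ) : ℝ≥0∞)⁻¹ • ∑ i ∈ Finset.range (n + 1), m i

lemma averageMeasure_apply (m : ℕ → Measure E) (n : ℕ) (s : Set E) :
    averageMeasure m n s = ((n + 1 : ℕ) : ℝ≥0∞)⁻¹ * ∑ i ∈ Finset.range (n + 1), m i s := by
  simp [averageMeasure]

lemma lintegral_averageMeasure (m : ℕ → Measure E) (n : ℕ) (f : E → ℝ≥0∞) :
    ∫⁻ x, f x ∂(averageMeasure m n)
      = ((n + 1 : ℕ) : ℝ≥0∞)⁻¹ * ∑ i ∈ Finset.range (n + 1), ∫⁻ x, f x ∂(m i) := by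
  simp [averageMeasure, lintegral_smul_measure, lintegral_finsetSum_measure]

lemma map_averageMeasure (m : ℕ → Measure E) (n : ℕ) {f : E → F} (hf : Measurable f) :
    (averageMeasure m n).map f = averageMeasure (fun i ↦ (m i).map f) n := by
  ext s hs
  rw [Measure.map_apply hf hs, averageMeasure_apply, averageMeasure_apply]
  simp only [Measure.map_apply hf hs]

instance isProbabilityMeasure_averageMeasure (m : ℕ → Measure E)
    [∀ i, IsProbabilityMeasure (m i)] (n : ℕ) : IsProbabilityMeasure (averageMeasure m n) where
  measure_univ := by
    rw [averageMeasure_apply]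
    simp only [measure_univ, Finset.sum_const, Finset.card_range, nsmul_eq_mul, mul_one]
    exact ENNReal.inv_mul_cancel (by simp) (ENNReal.natCast_ne_top _)

/-- `averageMeasure` as a sequence of probability measures. -/
noncomputable def averageProbabilityMeasure (m : ℕ → Measure E)
    [∀ i, IsProbabilityMeasure (m i)] (n : ℕ) : ProbabilityMeasure E :=
  ⟨averageMeasure m n, inferInstance⟩

lemma ofReal_average (a : ℕ → ℝ) (ha : ∀ i, 0 ≤ a i) (n : ℕ) :
    ENNReal.ofReal ((∑ i ∈ Finset.range (n + 1), a i) / (n + 1 : ℕ))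
      = ((n + 1 : ℕ) : ℝ≥0∞)⁻¹ * ∑ i ∈ Finset.range (n + 1), ENNReal.ofReal (a i) := by
  rw [ENNReal.ofReal_div_of_pos (by positivity), ENNReal.ofReal_sum_of_nonneg (fun i _ ↦ ha i),
    ENNReal.ofReal_natCast, div_eq_mul_inv, mul_comm]

/-- The strong law of large numbers along the coordinates of an infinite product. -/
lemma ae_tendsto_average_infinitePi (π : Measure E) [IsProbabilityMeasure π] {f : E → ℝ}
    (hf : Measurable f) (hint : Integrable f π) :
    ∀ᵐ ω ∂(Measure.infinitePi fun _ : ℕ ↦ π),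
      Tendsto (fun n : ℕ ↦ (∑ i ∈ Finset.range (n + 1), f (ω i)) / (n + 1 : ℕ)) atTop
        (𝓝 (∫ x, f x ∂π)) := by
  have hlaw (i : ℕ) : (Measure.infinitePi fun _ : ℕ ↦ π).map (fun ω ↦ ω i) = π :=
    Measure.infinitePi_map_eval _ i
  have hmp (i : ℕ) : MeasurePreserving (fun ω : ℕ → E ↦ ω i)
      (Measure.infinitePi fun _ : ℕ ↦ π) π := ⟨measurable_pi_apply i, hlaw i⟩
  have hid (i : ℕ) : IdentDistrib (fun ω : ℕ → E ↦ f (ω i)) f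
      (Measure.infinitePi fun _ : ℕ ↦ π) π :=
    ⟨(hf.comp (measurable_pi_apply i)).aemeasurable, hf.aemeasurable, by
      conv_rhs => rw [← hlaw i, Measure.map_map hf (measurable_pi_apply i)]
      rfl⟩
  have hind := iIndepFun_infinitePi (P := fun _ : ℕ ↦ π) (X := fun _ ↦ f) (fun _ ↦ hf)
  have h := strong_law_ae_real (fun i (ω : ℕ → E) ↦ f (ω i))
    ((hmp 0).integrable_comp_of_integrable hint) (fun i j hij ↦ hind.indepFun hij)
    (fun i ↦ (hid i).trans (hid 0).symm)
  filter_upwards [h] with ω hω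
  have : ∫ ω, f (ω 0) ∂(Measure.infinitePi fun _ : ℕ ↦ π) = ∫ x, f x ∂π := (hid 0).integral_eq
  rw [this] at hω
  -- The shift passes from `n` to `n + 1` terms, so that no average is empty and each is a
  -- probability measure.
  exact hω.comp (tendsto_add_atTop_nat 1)

end Empirical

/-! ### Almost sure weak convergence of empirical mixtures. -/

section WeakConvergence

variable {X : Type*} [MeasurableSpace X] {S : Type*} [MeasurableSpace S]

lemma ae_tendsto_averageMeasure_apply (π : Measure X) [IsProbabilityMeasure π]
    (Q : Kernel X S) [IsMarkovKernel Q] {A : Set S} (hA : MeasurableSet A) :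
    ∀ᵐ ω ∂(Measure.infinitePi fun _ : ℕ ↦ π),
      Tendsto (fun n ↦ averageMeasure (fun i ↦ Q (ω i)) n A) atTop (𝓝 (π.bind Q A)) := by
  have hint : Integrable (fun x ↦ (Q x A).toReal) π := by
    refine Integrable.of_bound (Q.measurable_coe hA).ennreal_toReal.aestronglyMeasurable 1
      (ae_of_all _ fun x ↦ ?_)
    rw [Real.norm_of_nonneg ENNReal.toReal_nonneg]
    exact measureReal_le_one
  filter_upwards [ae_tendsto_average_infinitePi π (Q.measurable_coe hA).ennreal_toReal hint]
    with ω hω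
  have h := (ENNReal.continuous_ofReal.tendsto _).comp hω
  have hlim : ENNReal.ofReal (∫ x, (Q x A).toReal ∂π) = π.bind Q A := by
    rw [Measure.bind_apply hA Q.aemeasurable, ofReal_integral_eq_lintegral_ofReal hint
      (ae_of_all _ fun _ ↦ ENNReal.toReal_nonneg)]
    simp [ENNReal.ofReal_toReal]
  rw [hlim] at h
  refine h.congr fun n ↦ ?_
  rw [Function.comp_apply, ofReal_average _ (fun _ ↦ ENNReal.toReal_nonneg), averageMeasure_apply]
  simp [ENNReal.ofReal_toReal]

/-- Empirical averages of a Markov kernel converge weakly, almost surely. -/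
lemma ae_tendsto_averageMeasure [TopologicalSpace S] [BorelSpace S] [SecondCountableTopology S]
    (π : Measure X) [IsProbabilityMeasure π] (Q : Kernel X S) [IsMarkovKernel Q]
    (μ : ProbabilityMeasure S) (hμ : (μ : Measure S) = π.bind Q) :
    ∀ᵐ ω ∂(Measure.infinitePi fun _ : ℕ ↦ π),
      Tendsto (averageProbabilityMeasure fun i ↦ Q (ω i)) atTop (𝓝 μ) := by
  let B := TopologicalSpace.countableBasis S
  have hBc : B.Countable := TopologicalSpace.countable_countableBasis S
  have hB : TopologicalSpace.IsTopologicalBasis B :=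
    TopologicalSpace.isBasis_countableBasis S
  -- Finite unions of basic open sets are countably many, so one null set serves them all; they also
  -- exhaust every open set in measure, which suffices for the open-set criterion.
  let T : Set (Set (Set S)) := {t | t.Finite ∧ t ⊆ B}
  have hT : T.Countable := Set.countable_ofPred_finite_subset hBc
  have hopen (t : Set (Set S)) (ht : t ⊆ B) : IsOpen (⋃₀ t) :=
    isOpen_sUnion fun s hs ↦ hB.isOpen (ht hs)
  have hall : ∀ᵐ ω ∂(Measure.infinitePi fun _ : ℕ ↦ π), ∀ t ∈ T,
      Tendsto (fun n ↦ averageMeasure (fun i ↦ Q (ω i)) n (⋃₀ t)) atTop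
        (𝓝 (π.bind Q (⋃₀ t))) := by
    rw [ae_ball_iff hT]
    exact fun t ht ↦ ae_tendsto_averageMeasure_apply π Q (hopen t ht.2).measurableSet
  filter_upwards [hall] with ω hω
  refine tendsto_of_forall_isOpen_le_liminf_nat' fun G hG ↦ ?_
  refine le_of_forall_lt fun r hr ↦ ?_
  have hr' : r < μ G := by simpa using hr
  lift r to NNReal using (hr.trans (measure_lt_top _ _)).ne
  obtain ⟨t, ht, hrt, htG⟩ := μ.exists_lt_measure_biUnion_of_isOpen (S := B)
    (fun u hu x hx ↦ by
      obtain ⟨s, hs, hxs, hsu⟩ := hB.exists_subset_of_mem_open hx hu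
      exact ⟨s, hs, (hB.isOpen hs).mem_nhds hxs, hsu⟩) hG (by exact_mod_cast hr')
  have hlim := hω (↑t) ⟨t.finite_toSet, ht⟩
  have hrt' : (r : ℝ≥0∞) < π.bind Q (⋃₀ (↑t : Set (Set S))) := by
    rw [← hμ, Set.sUnion_eq_biUnion, ← ProbabilityMeasure.ennreal_coeFn_eq_coeFn_toMeasure]
    exact_mod_cast hrt
  refine hrt'.trans_le ?_
  rw [← hlim.liminf_eq]
  refine liminf_le_liminf (Eventually.of_forall fun n ↦ measure_mono ?_)
  rwa [Set.sUnion_eq_biUnion]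

end WeakConvergence

/-! ### Limits of couplings and convexity of the transport cost. -/

section Couplings

/-- Portmanteau: integrals of non-negative lower semi-continuous functions are lower
semi-continuous for the weak convergence of probability measures. -/
lemma lintegral_le_liminf_of_lowerSemicontinuous {E : Type*} [TopologicalSpace E]
    [MeasurableSpace E] [OpensMeasurableSpace E] [HasOuterApproxClosed E]
    {γ : ProbabilityMeasure E} {γs : ℕ → ProbabilityMeasure E} (h : Tendsto γs atTop (𝓝 γ))
    {f : E → ℝ} (hf : LowerSemicontinuous f) (hf0 : 0 ≤ f) :
    ∫⁻ x, ENNReal.ofReal (f x) ∂(γ : Measure E)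
      ≤ liminf (fun n ↦ ∫⁻ x, ENNReal.ofReal (f x) ∂(γs n : Measure E)) atTop := by
  -- The layer-cake formula reduces to the open sets `{t < f}`, where the portmanteau inequality
  -- applies; Fatou's lemma in `t` concludes.
  simp_rw [lintegral_eq_lintegral_meas_lt _ (Eventually.of_forall hf0) hf.measurable.aemeasurable]
  calc ∫⁻ t in Set.Ioi (0 : ℝ), (γ : Measure E) {a | t < f a}
      ≤ ∫⁻ t in Set.Ioi (0 : ℝ), liminf (fun i ↦ (γs i : Measure E) {a | t < f a}) atTop :=
        lintegral_mono fun t ↦ ProbabilityMeasure.le_liminf_measure_open_of_tendsto h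
          (hf.isOpen_preimage t)
    _ ≤ _ := lintegral_liminf_le fun n ↦ Antitone.measurable fun s t hst ↦
          measure_mono fun ω hω ↦ lt_of_le_of_lt hst hω

variable {S : Type*} [MetricSpace S] [MeasurableSpace S] [BorelSpace S]

/-- The complement of `K ×ˢ L` is covered by two cylinders whose masses are read off the marginals.
-/
lemma isTightMeasureSet_range_of_couplings {μs νs : ℕ → Measure S}
    (hμ : IsTightMeasureSet (Set.range μs)) (hν : IsTightMeasureSet (Set.range νs))
    {γs : ℕ → Measure (S × S)} (hγ : ∀ n, γs n ∈ couplings (μs n) (νs n)) :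
    IsTightMeasureSet (Set.range γs) := by
  rw [isTightMeasureSet_iff_exists_isCompact_measure_compl_le] at *
  intro ε hε
  obtain ⟨K, hK, hK'⟩ := hμ (ε / 2) (ENNReal.half_pos hε.ne')
  obtain ⟨L, hL, hL'⟩ := hν (ε / 2) (ENNReal.half_pos hε.ne')
  refine ⟨K ×ˢ L, hK.prod hL, ?_⟩
  rintro _ ⟨n, rfl⟩
  calc γs n (K ×ˢ L)ᶜ ≤ γs n (Prod.fst ⁻¹' Kᶜ ∪ Prod.snd ⁻¹' Lᶜ) := by
        refine measure_mono fun z hz ↦ ?_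
        by_contra h
        simp only [Set.mem_union, Set.mem_preimage, Set.mem_compl_iff, not_or, not_not] at h
        exact hz h
    _ ≤ γs n (Prod.fst ⁻¹' Kᶜ) + γs n (Prod.snd ⁻¹' Lᶜ) := measure_union_le _ _
    _ = μs n Kᶜ + νs n Lᶜ := by
        rw [← Measure.map_apply measurable_fst hK.measurableSet.compl, (hγ n).1,
          ← Measure.map_apply measurable_snd hL.measurableSet.compl, (hγ n).2]
    _ ≤ ε / 2 + ε / 2 := add_le_add (hK' _ ⟨n, rfl⟩) (hL' _ ⟨n, rfl⟩)
    _ = ε := ENNReal.add_halves ε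

variable [CompleteSpace S] [SecondCountableTopology S]

/-- A convergent sequence together with its limit is compact, and relatively compact families on a
Polish space are tight. -/
lemma isTightMeasureSet_range_of_tendsto {μ : ProbabilityMeasure S}
    {μs : ℕ → ProbabilityMeasure S} (h : Tendsto μs atTop (𝓝 μ)) :
    IsTightMeasureSet (Set.range fun n ↦ (μs n : Measure S)) := by
  have hc : IsCompact (closure (insert μ (Set.range μs))) :=
    h.isCompact_insert_range.closure
  refine (isTightMeasureSet_of_isCompact_closure hc).subset ?_
  rintro _ ⟨n, rfl⟩
  exact ⟨μs n, Or.inr ⟨n, rfl⟩, rfl⟩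

/-- Stability of couplings with bounded transport cost under weak convergence of the marginals. -/
lemma exists_coupling_lintegral_le_of_tendsto {μ ν : ProbabilityMeasure S}
    {μs νs : ℕ → ProbabilityMeasure S} (hμ : Tendsto μs atTop (𝓝 μ))
    (hν : Tendsto νs atTop (𝓝 ν)) {γs : ℕ → ProbabilityMeasure (S × S)}
    (hγ : ∀ n, (γs n : Measure (S × S)) ∈ couplings (μs n : Measure S) (νs n : Measure S))
    {f : S × S → ℝ} (hf : LowerSemicontinuous f) (hf0 : 0 ≤ f) {a : ℕ → ℝ≥0∞} {b : ℝ≥0∞}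
    (hle : ∀ n, ∫⁻ z, ENNReal.ofReal (f z) ∂(γs n : Measure (S × S)) ≤ a n)
    (ha : Tendsto a atTop (𝓝 b)) :
    ∃ γ ∈ couplings (μ : Measure S) (ν : Measure S), ∫⁻ z, ENNReal.ofReal (f z) ∂γ ≤ b := by
  have htight := isTightMeasureSet_range_of_couplings (isTightMeasureSet_range_of_tendsto hμ)
    (isTightMeasureSet_range_of_tendsto hν) hγ
  have hcomp : IsCompact (closure (Set.range γs)) := by
    refine isCompact_closure_of_isTightMeasureSet (htight.subset ?_)
    rintro _ ⟨_, ⟨n, rfl⟩, rfl⟩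
    exact ⟨n, rfl⟩
  obtain ⟨γ, -, sub, hsub, hlim⟩ :=
    hcomp.isSeqCompact (x := γs) (fun n ↦ subset_closure ⟨n, rfl⟩)
  refine ⟨γ, ⟨?_, ?_⟩, ?_⟩
  · have h1 := ProbabilityMeasure.tendsto_map_of_tendsto_of_continuous _ _ hlim
      (continuous_fst (X := S) (Y := S))
    have h2 : (fun i ↦ ((γs ∘ sub) i).map (continuous_fst (X := S) (Y := S)).measurable.aemeasurable)
        = μs ∘ sub := by
      funext i
      exact Subtype.ext (hγ (sub i)).1
    rw [h2] at h1
    exact congrArg (fun ρ : ProbabilityMeasure S ↦ (ρ : Measure S)) (tendsto_nhds_unique h1 (hμ.comp hsub.tendsto_atTop))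
  · have h1 := ProbabilityMeasure.tendsto_map_of_tendsto_of_continuous _ _ hlim
      (continuous_snd (X := S) (Y := S))
    have h2 : (fun i ↦ ((γs ∘ sub) i).map (continuous_snd (X := S) (Y := S)).measurable.aemeasurable)
        = νs ∘ sub := by
      funext i
      exact Subtype.ext (hγ (sub i)).2
    rw [h2] at h1
    exact congrArg (fun ρ : ProbabilityMeasure S ↦ (ρ : Measure S)) (tendsto_nhds_unique h1 (hν.comp hsub.tendsto_atTop))
  · refine (lintegral_le_liminf_of_lowerSemicontinuous hlim hf hf0).trans ?_
    rw [← (ha.comp hsub.tendsto_atTop).liminf_eq]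
    exact liminf_le_liminf (Eventually.of_forall fun n ↦ hle (sub n))

/-- Joint convexity of the transport cost for mixtures: couplings of `Q₁ x` and `Q₂ x` with cost
at most `c x` yield a coupling of the mixtures with cost at most `∫ c`. -/
lemma exists_coupling_bind {X : Type*} [MeasurableSpace X] (π : Measure X)
    [IsProbabilityMeasure π] (Q₁ Q₂ : Kernel X S) [IsMarkovKernel Q₁] [IsMarkovKernel Q₂]
    {f : S × S → ℝ} (hf : LowerSemicontinuous f) (hf0 : 0 ≤ f) {c : X → ℝ} (hc : Measurable c)
    (hc0 : 0 ≤ c) (hint : Integrable c π)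
    (h : ∀ x, ∃ γ ∈ couplings (Q₁ x) (Q₂ x),
      ∫⁻ z, ENNReal.ofReal (f z) ∂γ ≤ ENNReal.ofReal (c x)) :
    ∃ γ ∈ couplings (π.bind Q₁) (π.bind Q₂),
      ∫⁻ z, ENNReal.ofReal (f z) ∂γ ≤ ENNReal.ofReal (∫ x, c x ∂π) := by
  -- No measurability of `K` is needed: it is only evaluated along one sample `ω`.
  choose K hK hKc using h
  have hKp (x : X) : IsProbabilityMeasure (K x) := by
    have : IsProbabilityMeasure ((K x).map Prod.fst) := by rw [(hK x).1]; infer_instance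
    exact Measure.isProbabilityMeasure_of_map Prod.fst
  obtain ⟨ω, h₁, h₂, h₃⟩ := ((ae_tendsto_averageMeasure π Q₁ ⟨π.bind Q₁, inferInstance⟩ rfl).and
    ((ae_tendsto_averageMeasure π Q₂ ⟨π.bind Q₂, inferInstance⟩ rfl).and
      (ae_tendsto_average_infinitePi π hc hint))).exists
  refine exists_coupling_lintegral_le_of_tendsto h₁ h₂
    (γs := averageProbabilityMeasure fun i ↦ K (ω i)) (fun n ↦ ⟨?_, ?_⟩) hf hf0
    (fun n ↦ ?_) ((ENNReal.continuous_ofReal.tendsto _).comp h₃)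
  · exact (map_averageMeasure _ n measurable_fst).trans (by simp only [(hK _).1]; rfl)
  · exact (map_averageMeasure _ n measurable_snd).trans (by simp only [(hK _).2]; rfl)
  · refine (lintegral_averageMeasure _ n _).trans_le ?_
    rw [Function.comp_apply, ofReal_average _ fun i ↦ hc0 (ω i)]
    gcongr
    exact hKc _

end Couplings

/-! ### Elementary properties of couplings, transport costs and kernel powers. -/

section Contraction

variable {S : Type*} [MeasurableSpace S]

lemma mem_couplings_diagonal (μ : Measure S) : μ.map (fun x ↦ (x, x)) ∈ couplings μ μ := by
  have h : Measurable fun x : S ↦ (x, x) := measurable_id.prodMk measurable_id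
  exact ⟨(Measure.map_map measurable_fst h).trans Measure.map_id,
    (Measure.map_map measurable_snd h).trans Measure.map_id⟩

lemma isProbabilityMeasure_of_mem_couplings {μ ν : Measure S} [IsProbabilityMeasure μ]
    {γ : Measure (S × S)} (hγ : γ ∈ couplings μ ν) : IsProbabilityMeasure γ := by
  have : IsProbabilityMeasure (γ.map Prod.fst) := by rw [hγ.1]; infer_instance
  exact Measure.isProbabilityMeasure_of_map Prod.fst

lemma kantorovich_le {φ : S × S → ℝ} {μ ν : Measure S} {γ : Measure (S × S)}
    (hγ : γ ∈ couplings μ ν) : kantorovich φ μ ν ≤ ∫⁻ z, ENNReal.ofReal (φ z) ∂γ :=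
  iInf₂_le γ hγ

lemma exists_coupling_of_kantorovich_lt {φ : S × S → ℝ} {μ ν : Measure S} {a : ℝ≥0∞}
    (h : kantorovich φ μ ν < a) :
    ∃ γ ∈ couplings μ ν, ∫⁻ z, ENNReal.ofReal (φ z) ∂γ ≤ a := by
  simp only [kantorovich, iInf_lt_iff] at h
  obtain ⟨γ, hγ, h⟩ := h
  exact ⟨γ, hγ, h.le⟩

lemma kantorovich_le_mul {φ f : S × S → ℝ} {A : ℝ} (hA : 0 < A) (h : ∀ z, φ z ≤ A * f z)
    (μ ν : Measure S) : kantorovich φ μ ν ≤ ENNReal.ofReal A * kantorovich f μ ν := by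
  have hA' : ENNReal.ofReal A ≠ 0 := by simpa using hA
  simp only [kantorovich, ENNReal.mul_iInf_of_ne hA' ENNReal.ofReal_ne_top]
  refine iInf₂_mono fun π _ ↦ ?_
  rw [← lintegral_const_mul' _ _ ENNReal.ofReal_ne_top]
  refine lintegral_mono fun z ↦ ?_
  rw [← ENNReal.ofReal_mul hA.le]
  exact ENNReal.ofReal_le_ofReal (h z)

lemma bind_comap_fst (π : Measure (S × S)) (P : Kernel S S) :
    π.bind (P.comap Prod.fst measurable_fst : Kernel (S × S) S) = (π.map Prod.fst).bind P := by
  ext s hs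
  rw [Measure.bind_apply hs (Kernel.aemeasurable _), Measure.bind_apply hs P.aemeasurable,
    lintegral_map (P.measurable_coe hs) measurable_fst]
  rfl

lemma bind_comap_snd (π : Measure (S × S)) (P : Kernel S S) :
    π.bind (P.comap Prod.snd measurable_snd : Kernel (S × S) S) = (π.map Prod.snd).bind P := by
  ext s hs
  rw [Measure.bind_apply hs (Kernel.aemeasurable _), Measure.bind_apply hs P.aemeasurable,
    lintegral_map (P.measurable_coe hs) measurable_snd]
  rfl

lemma bind_pow_succ (μ : Measure S) (P : Kernel S S) (n : ℕ) :
    μ.bind (P ^ (n + 1) : Kernel S S) = (μ.bind (P ^ n : Kernel S S)).bind P := by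
  rw [pow_succ']
  exact Measure.comp_assoc.symm

lemma isMarkovKernel_pow (P : Kernel S S) [IsMarkovKernel P] (n : ℕ) :
    IsMarkovKernel (P ^ n) := by
  induction n with
  | zero => rw [pow_zero]; exact inferInstanceAs (IsMarkovKernel Kernel.id)
  | succ n ih => rw [pow_succ']; exact inferInstanceAs (IsMarkovKernel (P ∘ₖ (P ^ n : Kernel S S)))

end Contraction

/-! ### From contraction on Dirac masses to exponential decay. -/

section Polish

variable {S : Type*} [MetricSpace S] [CompleteSpace S] [SecondCountableTopology S]
  [MeasurableSpace S] [BorelSpace S]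

/-- A pointwise contraction estimate on Dirac masses extends to all probability measures. -/
lemma kantorovich_bind_le {f : S × S → ℝ} (hf : LowerSemicontinuous f) (hf0 : 0 ≤ f)
    (P : Kernel S S) [IsMarkovKernel P] {lam : ℝ} (hlam : 0 < lam)
    (h : ∀ x y, ∃ γ ∈ couplings (P x) (P y),
      ∫⁻ z, ENNReal.ofReal (f z) ∂γ ≤ ENNReal.ofReal (lam * f (x, y)))
    (μ ν : Measure S) [IsProbabilityMeasure μ] :
    kantorovich f (μ.bind P) (ν.bind P) ≤ ENNReal.ofReal lam * kantorovich f μ ν := by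
  -- Moving `lam` to the left isolates the infimum, so a single coupling of `μ` and `ν` can be
  -- fixed.
  rw [mul_comm, ← ENNReal.div_le_iff (by simpa using hlam) ENNReal.ofReal_ne_top]
  refine le_iInf₂ fun π hπ ↦ ?_
  rw [ENNReal.div_le_iff (by simpa using hlam) ENNReal.ofReal_ne_top, mul_comm]
  have := isProbabilityMeasure_of_mem_couplings hπ
  by_cases htop : ∫⁻ z, ENNReal.ofReal (f z) ∂π = ∞
  · rw [htop, ENNReal.mul_top (by simpa using hlam)]
    exact le_top
  have hint : Integrable f π := by
    refine ⟨hf.measurable.aestronglyMeasurable, ?_⟩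
    rw [hasFiniteIntegral_iff_ofReal (ae_of_all _ hf0)]
    exact lt_top_iff_ne_top.2 htop
  obtain ⟨γ, hγ, hle⟩ := exists_coupling_bind π (P.comap Prod.fst measurable_fst)
    (P.comap Prod.snd measurable_snd) hf hf0 (hf.measurable.const_mul lam)
    (fun z ↦ mul_nonneg hlam.le (hf0 z)) (hint.const_mul lam) (fun z ↦ h z.1 z.2)
  rw [bind_comap_fst, bind_comap_snd, hπ.1, hπ.2] at hγ
  refine (kantorovich_le hγ).trans (hle.trans_eq ?_)
  rw [integral_const_mul, ENNReal.ofReal_mul hlam.le,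
    ofReal_integral_eq_lintegral_ofReal hint (ae_of_all _ hf0)]

lemma kantorovich_bind_pow_le {f : S × S → ℝ} (hf : LowerSemicontinuous f) (hf0 : 0 ≤ f)
    (P : Kernel S S) [IsMarkovKernel P] {lam : ℝ} (hlam : 0 < lam)
    (h : ∀ x y, ∃ γ ∈ couplings (P x) (P y),
      ∫⁻ z, ENNReal.ofReal (f z) ∂γ ≤ ENNReal.ofReal (lam * f (x, y)))
    (μ ν : Measure S) [IsProbabilityMeasure μ] (n : ℕ) :
    kantorovich f (μ.bind (P ^ n : Kernel S S)) (ν.bind (P ^ n : Kernel S S))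
      ≤ ENNReal.ofReal (lam ^ n) * kantorovich f μ ν := by
  induction n with
  | zero =>
    have hid (ρ : Measure S) : ρ.bind ((P ^ 0 : Kernel S S)) = ρ := Measure.id_comp
    rw [hid, hid]
    simp
  | succ n ih =>
    have := isMarkovKernel_pow P n
    rw [bind_pow_succ, bind_pow_succ, pow_succ', ENNReal.ofReal_mul hlam.le, mul_assoc]
    exact (kantorovich_bind_le hf hf0 P hlam h _ _).trans (by gcongr)

/-- A one-step contraction for a cost equivalent to `φ` gives exponential decay for `φ`. -/
lemma exponentialDecay_of_contraction {V : S → ℝ} {φ f : S × S → ℝ} (hf : LowerSemicontinuous f)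
    (hf0 : 0 ≤ f) (P : Kernel S S) [IsMarkovKernel P] {lam : ℝ} (hlam : 0 < lam) (hlam1 : lam < 1)
    (h : ∀ x y, ∃ γ ∈ couplings (P x) (P y),
      ∫⁻ z, ENNReal.ofReal (f z) ∂γ ≤ ENNReal.ofReal (lam * f (x, y)))
    {A B : ℝ} (hA : 0 < A) (hB : 0 < B) (hφ : ∀ z, φ z ≤ A * f z) (hfφ : ∀ z, f z ≤ B * φ z) :
    ExponentialDecay V φ P := by
  refine ⟨A * B, lam, mul_nonneg hA.le hB.le, hlam, hlam1, fun n ↦ ?_⟩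
  refine iSup₂_le fun μ hμ ↦ iSup₂_le fun ν hν ↦ iSup_le fun _ ↦ ENNReal.div_le_of_le_mul ?_
  have := hμ.1
  calc kantorovich φ (μ.bind (P ^ n : Kernel S S)) (ν.bind (P ^ n : Kernel S S))
      ≤ ENNReal.ofReal A * kantorovich f (μ.bind (P ^ n : Kernel S S)) (ν.bind (P ^ n : Kernel S S)) :=
        kantorovich_le_mul hA hφ _ _
    _ ≤ ENNReal.ofReal A * (ENNReal.ofReal (lam ^ n) * (ENNReal.ofReal B * kantorovich φ μ ν)) := by
        gcongr
        refine (kantorovich_bind_pow_le hf hf0 P hlam h μ ν n).trans ?_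
        gcongr
        exact kantorovich_le_mul hB hfφ _ _
    _ = ENNReal.ofReal (A * B * lam ^ n) * kantorovich φ μ ν := by
        rw [ENNReal.ofReal_mul (mul_nonneg hA.le hB.le), ENNReal.ofReal_mul hA.le]
        ring

end Polish

/-! ### Lower semi-continuity of the costs. -/

section Semicontinuity

variable {E : Type*} [TopologicalSpace E]

lemma lowerSemicontinuous_mul_of_nonneg {f g : E → ℝ} (hf : LowerSemicontinuous f)
    (hg : LowerSemicontinuous g) (hf0 : 0 ≤ f) (hg0 : 0 ≤ g) :
    LowerSemicontinuous fun x ↦ f x * g x := by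
  intro x y hy
  rcases lt_or_ge y 0 with h0 | h0
  · exact Eventually.of_forall fun z ↦ h0.trans_le (mul_nonneg (hf0 z) (hg0 z))
  obtain ⟨a, ha, hax, b, hb, hbx, hab⟩ : ∃ a ≥ 0, a < f x ∧ ∃ b ≥ 0, b < g x ∧ y < a * b := by
    by_contra! hcon
    exact (mul_le_of_forall_lt_of_nonneg (hf0 x) h0 hcon).not_gt hy
  filter_upwards [hf x a hax, hg x b hbx] with z hz hz'
  exact hab.trans_le (mul_le_mul hz.le hz'.le hb (hf0 z))

lemma lowerSemicontinuous_rpow_of_nonneg {f : E → ℝ} (hf : LowerSemicontinuous f) (hf0 : 0 ≤ f)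
    {p : ℝ} (hp : 0 ≤ p) : LowerSemicontinuous fun x ↦ f x ^ p := by
  -- Truncation at `0` makes the power monotone on all of `ℝ` without changing it on the values of
  -- `f`.
  have hm : Monotone fun t : ℝ ↦ (max t 0) ^ p := fun s t hst ↦
    Real.rpow_le_rpow (le_max_right _ _) (max_le_max_right 0 hst) hp
  have hc : Continuous fun t : ℝ ↦ (max t 0) ^ p :=
    (continuous_id.max continuous_const).rpow_const fun _ ↦ Or.inr hp
  have h := hc.comp_lowerSemicontinuous hf hm
  have heq : (fun t : ℝ ↦ (max t 0) ^ p) ∘ f = fun x ↦ f x ^ p := by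
    funext x
    have h0 : 0 ≤ f x := hf0 x
    simp only [Function.comp_apply, max_eq_left h0]
  rwa [heq] at h

lemma lowerSemicontinuous_varpi {V : E → ℝ} (hV : LowerSemicontinuous V) :
    LowerSemicontinuous (varpi V) :=
  (hV.comp continuous_fst).add (hV.comp continuous_snd)

lemma discreteCost_nonneg {S : Type*} : 0 ≤ discreteCost (S := S) := fun _ ↦
  Set.indicator_nonneg (fun _ _ ↦ zero_le_one) _

lemma lowerSemicontinuous_discreteCost [T2Space E] :
    LowerSemicontinuous (discreteCost (S := E)) :=
  isClosed_diagonal.isOpen_compl.lowerSemicontinuous_indicator zero_le_one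

lemma discreteCost_self {S : Type*} (x : S) : discreteCost (x, x) = 0 := by
  simp [discreteCost]

lemma discreteCost_of_ne {S : Type*} {x y : S} (h : x ≠ y) : discreteCost (x, y) = 1 := by
  simp [discreteCost, h]

lemma discreteCost_le_one {S : Type*} (z : S × S) : discreteCost z ≤ 1 :=
  Set.indicator_le_self' (fun _ _ ↦ zero_le_one) z

end Semicontinuity

/-! ### Shifting the weight by a constant. -/

section Weights

variable {S : Type*}

lemma varpi_add_const (V : S → ℝ) (b : ℝ) (z : S × S) :
    varpi (fun x ↦ V x + b) z = varpi V z + 2 * b := by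
  simp only [varpi]; ring

lemma varpi_pos {V : S → ℝ} (hV : ∀ x, 0 < V x) (z : S × S) : 0 < varpi V z :=
  add_pos (hV _) (hV _)

lemma weightedDiscreteCost_nonneg {V : S → ℝ} (hV : ∀ x, 0 < V x) :
    0 ≤ weightedDiscreteCost V := fun z ↦
  mul_nonneg (discreteCost_nonneg z) (varpi_pos hV z).le

lemma weightedDiscreteCost_le_varpi {V : S → ℝ} (hV : ∀ x, 0 < V x) (z : S × S) :
    weightedDiscreteCost V z ≤ varpi V z :=
  mul_le_of_le_one_left (varpi_pos hV z).le (discreteCost_le_one z)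

lemma weightedDiscreteCost_le_add_const (V : S → ℝ) {b : ℝ} (hb : 0 ≤ b) (z : S × S) :
    weightedDiscreteCost V z ≤ weightedDiscreteCost (fun x ↦ V x + b) z := by
  simp only [weightedDiscreteCost, varpi_add_const]
  exact mul_le_mul_of_nonneg_left (by linarith) (discreteCost_nonneg z)

/-- As `ϖ_V ≥ 2δ`, the added `2b` is at most `(b / δ) ϖ_V`. This is the harder half of the
equivalence of shifted and original costs. -/
lemma weightedDiscreteCost_add_const_le {V : S → ℝ} {δ : ℝ} (hδ : 0 < δ) (hV : ∀ x, δ ≤ V x)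
    {b : ℝ} (hb : 0 ≤ b) (z : S × S) :
    weightedDiscreteCost (fun x ↦ V x + b) z ≤ (1 + b / δ) * weightedDiscreteCost V z := by
  simp only [weightedDiscreteCost, varpi_add_const]
  rw [mul_left_comm]
  refine mul_le_mul_of_nonneg_left ?_ (discreteCost_nonneg z)
  have h : 2 * δ ≤ varpi V z := by
    have h₁ := hV z.1
    have h₂ := hV z.2
    simp only [varpi]; linarith
  have h' : b / δ * (2 * δ) = 2 * b := by field_simp
  have h'' := mul_le_mul_of_nonneg_left h (div_nonneg hb hδ.le)
  linarith

lemma lowerSemicontinuous_weightedDiscreteCost [TopologicalSpace S] [T2Space S] {V : S → ℝ}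
    (hV : LowerSemicontinuous V) (hV0 : ∀ x, 0 < V x) :
    LowerSemicontinuous (weightedDiscreteCost V) :=
  lowerSemicontinuous_mul_of_nonneg lowerSemicontinuous_discreteCost (lowerSemicontinuous_varpi hV)
    discreteCost_nonneg fun z ↦ (varpi_pos hV0 z).le

end Weights

/-! ### The drift condition along couplings. -/

section Drift

variable {S : Type*} [MeasurableSpace S]

/-- The drift condition transferred to couplings of `P x` and `P y`. -/
lemma lintegral_varpi_le {V : S → ℝ} (hVm : Measurable V) (hV0 : ∀ x, 0 < V x) {P : Kernel S S}
    {ε c : ℝ} (hε : 0 < ε) (hc : 0 ≤ c)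
    (hdrift : ∀ x, ∫⁻ y, ENNReal.ofReal (V y) ∂(P x) ≤ ENNReal.ofReal (ε * V x + c)) {x y : S}
    {γ : Measure (S × S)} (hγ : γ ∈ couplings (P x) (P y)) :
    ∫⁻ z, ENNReal.ofReal (varpi V z) ∂γ ≤ ENNReal.ofReal (ε * varpi V (x, y) + 2 * c) := by
  have hm := hVm.ennreal_ofReal
  have hpos (x : S) : 0 ≤ ε * V x + c := add_nonneg (mul_nonneg hε.le (hV0 x).le) hc
  calc ∫⁻ z, ENNReal.ofReal (varpi V z) ∂γ
      = ∫⁻ z, (ENNReal.ofReal (V z.1) + ENNReal.ofReal (V z.2)) ∂γ :=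
        lintegral_congr fun z ↦ ENNReal.ofReal_add (hV0 _).le (hV0 _).le
    _ = ∫⁻ z, ENNReal.ofReal (V z) ∂(P x) + ∫⁻ z, ENNReal.ofReal (V z) ∂(P y) := by
        rw [lintegral_add_left (by fun_prop), ← hγ.1, ← hγ.2,
          lintegral_map hm measurable_fst, lintegral_map hm measurable_snd]
    _ ≤ ENNReal.ofReal (ε * V x + c) + ENNReal.ofReal (ε * V y + c) :=
        add_le_add (hdrift x) (hdrift y)
    _ = ENNReal.ofReal (ε * varpi V (x, y) + 2 * c) := by
        rw [← ENNReal.ofReal_add (hpos x) (hpos y)]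
        congr 1
        simp only [varpi]; ring

/-- A coupling has mass one, so the shift contributes `2b` without the factor `ε`. -/
lemma lintegral_varpi_add_const_le {V : S → ℝ} (hVm : Measurable V) (hV0 : ∀ x, 0 < V x)
    {P : Kernel S S} [IsMarkovKernel P] {ε c : ℝ} (hε : 0 < ε) (hc : 0 ≤ c)
    (hdrift : ∀ x, ∫⁻ y, ENNReal.ofReal (V y) ∂(P x) ≤ ENNReal.ofReal (ε * V x + c)) {x y : S}
    {γ : Measure (S × S)} (hγ : γ ∈ couplings (P x) (P y)) {b : ℝ} (hb : 0 ≤ b) :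
    ∫⁻ z, ENNReal.ofReal (varpi (fun x ↦ V x + b) z) ∂γ
      ≤ ENNReal.ofReal (ε * varpi V (x, y) + 2 * c + 2 * b) := by
  have := isProbabilityMeasure_of_mem_couplings hγ
  have h0 := varpi_pos hV0 (x, y)
  calc ∫⁻ z, ENNReal.ofReal (varpi (fun x ↦ V x + b) z) ∂γ
      = ∫⁻ z, (ENNReal.ofReal (varpi V z) + ENNReal.ofReal (2 * b)) ∂γ :=
        lintegral_congr fun z ↦ by
          rw [varpi_add_const, ENNReal.ofReal_add (varpi_pos hV0 z).le (by positivity)]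
    _ = ∫⁻ z, ENNReal.ofReal (varpi V z) ∂γ + ENNReal.ofReal (2 * b) := by
        rw [lintegral_add_right _ measurable_const, lintegral_const, measure_univ, mul_one]
    _ ≤ ENNReal.ofReal (ε * varpi V (x, y) + 2 * c) + ENNReal.ofReal (2 * b) := by
        gcongr
        exact lintegral_varpi_le hVm hV0 hε hc hdrift hγ
    _ = _ := (ENNReal.ofReal_add (by positivity) (by positivity)).symm

end Drift

/-! ### Hölder's inequality, near-optimal couplings and choice of constants. -/

section Estimates

variable {S : Type*} [MeasurableSpace S]

/-- Hölder's inequality for the interpolated cost. -/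
lemma lintegral_interpolatedCost_le {V : S → ℝ} (hVm : Measurable V) (hV0 : ∀ x, 0 < V x)
    {κ : S × S → ℝ} (hκm : Measurable κ) (hκ0 : 0 ≤ κ) {ι : ℝ} (hι0 : 0 < ι) (hι1 : ι < 1)
    {γ : Measure (S × S)} {a b : ℝ} (ha : 0 ≤ a) (hb : 0 ≤ b)
    (hκ : ∫⁻ z, ENNReal.ofReal (κ z) ∂γ ≤ ENNReal.ofReal a)
    (hV : ∫⁻ z, ENNReal.ofReal (varpi V z) ∂γ ≤ ENNReal.ofReal b) :
    ∫⁻ z, ENNReal.ofReal (interpolatedCost V κ ι z) ∂γ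
      ≤ ENNReal.ofReal (a ^ ι * b ^ (1 - ι)) := by
  have hι : 0 ≤ 1 - ι := by linarith
  have hvm : Measurable (varpi V) := (hVm.comp measurable_fst).add (hVm.comp measurable_snd)
  calc ∫⁻ z, ENNReal.ofReal (interpolatedCost V κ ι z) ∂γ
      ≤ ∫⁻ z, ENNReal.ofReal (κ z) ^ ι * ENNReal.ofReal (varpi V z) ^ (1 - ι) ∂γ := by
        refine lintegral_mono fun z ↦ ?_
        have h0 := hκ0 z
        have h1 := varpi_pos hV0 z
        rw [ENNReal.ofReal_rpow_of_nonneg h0 hι0.le, ENNReal.ofReal_rpow_of_nonneg h1.le hι,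
          ← ENNReal.ofReal_mul (Real.rpow_nonneg h0 _)]
        refine ENNReal.ofReal_le_ofReal (mul_le_mul_of_nonneg_left ?_ (Real.rpow_nonneg h0 _))
        exact Real.rpow_le_rpow (weightedDiscreteCost_nonneg hV0 z)
          (weightedDiscreteCost_le_varpi hV0 z) hι
    _ ≤ (∫⁻ z, ENNReal.ofReal (κ z) ∂γ) ^ ι * (∫⁻ z, ENNReal.ofReal (varpi V z) ∂γ) ^ (1 - ι) :=
        ENNReal.lintegral_mul_norm_pow_le hκm.ennreal_ofReal.aemeasurable
          hvm.ennreal_ofReal.aemeasurable hι0.le hι (by ring)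
    _ ≤ ENNReal.ofReal a ^ ι * ENNReal.ofReal b ^ (1 - ι) := by gcongr
    _ = ENNReal.ofReal (a ^ ι * b ^ (1 - ι)) := by
        rw [ENNReal.ofReal_rpow_of_nonneg ha hι0.le, ENNReal.ofReal_rpow_of_nonneg hb hι,
          ← ENNReal.ofReal_mul (Real.rpow_nonneg ha _)]

/-- A cost vanishing at `(x, x)` is transported at zero price by the diagonal coupling. -/
lemma exists_coupling_self {f : S × S → ℝ} (hf : Measurable f) (hf0 : ∀ x, f (x, x) = 0)
    (μ : Measure S) (a : ℝ≥0∞) :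
    ∃ γ ∈ couplings μ μ, ∫⁻ z, ENNReal.ofReal (f z) ∂γ ≤ a := by
  refine ⟨_, mem_couplings_diagonal μ, ?_⟩
  have hd : Measurable fun x : S ↦ (x, x) := measurable_id.prodMk measurable_id
  rw [lintegral_map hf.ennreal_ofReal hd]
  simp [hf0]

/-- Under local contraction, couplings with a strictly contracting price exist on sublevel sets,
and couplings with a non-expanding price exist everywhere. -/
lemma exists_local_coupling {V : S → ℝ} {κ : S × S → ℝ} {P : Kernel S S}
    (hloc : LocalContraction V κ P) :
    ∃ r₀ : ℝ, 0 < r₀ ∧ ∀ r, r₀ ≤ r → ∃ s : ℝ, 0 < s ∧ s < 1 ∧ ∀ x y, 0 < κ (x, y) →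
      varpi V (x, y) ≤ r → ∃ γ ∈ couplings (P x) (P y),
        ∫⁻ z, ENNReal.ofReal (κ z) ∂γ ≤ ENNReal.ofReal (s * κ (x, y)) := by
  obtain ⟨r₀, α, hr₀, hα, h⟩ := hloc
  -- Halving `α` makes the bound strict when `κ (x, y) > 0`, so an actual coupling meets it without
  -- the infimum having to be attained.
  refine ⟨r₀, hr₀, fun r hr ↦ ⟨1 - α r / 2, ?_, ?_, fun x y hκ hxy ↦ ?_⟩⟩
  · linarith [hα r hr]
  · linarith [hα r hr]
  refine exists_coupling_of_kantorovich_lt ((h r hr x y hxy).trans_lt ?_)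
  have hα' := (hα r hr).1
  have hα'' := (hα r hr).2
  refine (ENNReal.ofReal_lt_ofReal_iff (mul_pos (by linarith) hκ)).2 ?_
  exact mul_lt_mul_of_pos_right (by linarith) hκ

/-- Decrease of the shifted weight away from its sublevel sets. -/
lemma exists_drift_ratio {ε c b : ℝ} (hε1 : ε < 1) (hb : 0 < b) {r : ℝ} (hr : 0 < r)
    (hrc : 4 * c ≤ (1 - ε) * r) (hε : 0 < ε) :
    ∃ t : ℝ, 0 < t ∧ t < 1 ∧ ∀ v, r ≤ v → ε * v + 2 * c + 2 * b ≤ t * (v + 2 * b) := by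
  -- Half of the gain `(1 - ε) v` absorbs `2c`, by the choice of `r`; the other half is a fixed
  -- fraction of `v + 2b`, because `v ≥ r / (2b + r) * (v + 2b)` for `v ≥ r`.
  refine ⟨1 - (1 - ε) / 2 * (r / (2 * b + r)), ?_, ?_, fun v hv ↦ ?_⟩
  · have : r / (2 * b + r) ≤ 1 := (div_le_one (by positivity)).2 (by linarith)
    nlinarith
  · have : 0 < r / (2 * b + r) := by positivity
    nlinarith
  · have h1 : r / (2 * b + r) * (v + 2 * b) ≤ v := by
      rw [div_mul_eq_mul_div, div_le_iff₀ (by positivity)]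
      nlinarith
    have h2 := mul_le_mul_of_nonneg_left h1 (by linarith : 0 ≤ (1 - ε) / 2)
    have h3 := mul_le_mul_of_nonneg_left hv (by linarith : 0 ≤ 1 - ε)
    linarith

/-- As `b → ∞` the product tends to `s ^ ι < 1`: a large shift dilutes the drift constant. -/
lemma exists_shift_interpolation {s c ι : ℝ} (hs0 : 0 < s) (hs1 : s < 1) (hι0 : 0 < ι) :
    ∃ b : ℝ, 0 < b ∧ s ^ ι * (1 + c / b) ^ (1 - ι) < 1 := by
  have h : Tendsto (fun b : ℝ ↦ s ^ ι * (1 + c / b) ^ (1 - ι)) atTop (𝓝 (s ^ ι * 1)) := by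
    refine Tendsto.const_mul _ ?_
    have h1 : Tendsto (fun b : ℝ ↦ 1 + c / b) atTop (𝓝 (1 + 0)) :=
      (tendsto_const_nhds.div_atTop tendsto_id).const_add 1
    rw [add_zero] at h1
    simpa using h1.rpow_const (p := 1 - ι) (Or.inl one_ne_zero)
  have hlt : s ^ ι * 1 < 1 := by
    rw [mul_one]; exact Real.rpow_lt_one hs0.le hs1 hι0
  obtain ⟨b, hb, hb'⟩ := ((eventually_gt_atTop 0).and (h.eventually_lt_const hlt)).exists
  exact ⟨b, hb, hb'⟩

end Estimates

/-! ### The one-step contractions for the shifted costs. -/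

section Main

variable {S : Type*} [MetricSpace S] [CompleteSpace S] [SecondCountableTopology S]
  [MeasurableSpace S] [BorelSpace S]

lemma interpolatedCost_nonneg {S : Type*} {V : S → ℝ} (hV : ∀ x, 0 < V x) {κ : S × S → ℝ}
    (hκ : 0 ≤ κ) (ι : ℝ) : 0 ≤ interpolatedCost V κ ι := fun z ↦
  mul_nonneg (Real.rpow_nonneg (hκ z) _) (Real.rpow_nonneg (weightedDiscreteCost_nonneg hV z) _)

/-- For `W = V + b`, the pair (factor on `κ`, factor on `ϖ_W`) is `(s, 1 + c / b)` below level `r`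
and `(1, t)` above it; Hölder turns both into a factor below one. The constants are fixed in the
order `r`, `s`, `b`, `t`, each depending on the earlier ones. -/
theorem exponentialDecay_interpolatedCost {V : S → ℝ} (hV : IsWeight V) {P : Kernel S S}
    [IsMarkovKernel P] (hdrift : DriftCondition V P) {κ : S × S → ℝ} (hκ : IsSemiDistance κ)
    (hloc : LocalContraction V κ P) {ι : ℝ} (hι0 : 0 < ι) (hι1 : ι < 1) :
    ExponentialDecay V (interpolatedCost V κ ι) P := by
  obtain ⟨hVl, δ, hδ, hVδ⟩ := hV
  obtain ⟨ε, c, hε0, hε1, hc, hdrift⟩ := hdrift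
  have hV0 (x : S) : 0 < V x := hδ.trans_le (hVδ x)
  have hκ0 : 0 ≤ κ := fun z ↦ hκ.nonneg z.1 z.2
  have hι' : 0 ≤ 1 - ι := by linarith
  obtain ⟨r₀, hr₀, hcoup⟩ := exists_local_coupling hloc
  obtain ⟨r, hrr₀, hrc⟩ : ∃ r, r₀ ≤ r ∧ 4 * c ≤ (1 - ε) * r := by
    refine ⟨max r₀ (4 * c / (1 - ε)), le_max_left _ _, ?_⟩
    rw [← div_le_iff₀' (by linarith)]
    exact le_max_right _ _
  obtain ⟨s, hs0, hs1, hs⟩ := hcoup r hrr₀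
  obtain ⟨b, hb, hsb⟩ := exists_shift_interpolation (c := c) hs0 hs1 hι0
  obtain ⟨t, ht0, ht1, ht⟩ := exists_drift_ratio hε1 hb (hr₀.trans_le hrr₀) hrc hε0
  set W : S → ℝ := fun x ↦ V x + b with hW
  have hW0 (x : S) : 0 < W x := add_pos (hV0 x) hb
  have hWl : LowerSemicontinuous W := hVl.add lowerSemicontinuous_const
  have hf0 := interpolatedCost_nonneg hW0 hκ0 ι
  have hfl : LowerSemicontinuous (interpolatedCost W κ ι) :=
    lowerSemicontinuous_mul_of_nonneg
      (lowerSemicontinuous_rpow_of_nonneg hκ.lowerSemicontinuous hκ0 hι0.le)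
      (lowerSemicontinuous_rpow_of_nonneg (lowerSemicontinuous_weightedDiscreteCost hWl hW0)
        (weightedDiscreteCost_nonneg hW0) hι')
      (fun z ↦ Real.rpow_nonneg (hκ0 z) _)
      (fun z ↦ Real.rpow_nonneg (weightedDiscreteCost_nonneg hW0 z) _)
  have hself (x : S) : interpolatedCost W κ ι (x, x) = 0 := by
    rw [interpolatedCost, (hκ.eq_zero_iff x x).2 rfl, Real.zero_rpow hι0.ne', zero_mul]
  have hpow (w : ℝ) (hw0 : 0 ≤ w) (u : ℝ) (hu0 : 0 ≤ u) (x y : S) (hxy : x ≠ y) :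
      (w * κ (x, y)) ^ ι * (u * varpi W (x, y)) ^ (1 - ι)
        = w ^ ι * u ^ (1 - ι) * interpolatedCost W κ ι (x, y) := by
    rw [Real.mul_rpow hw0 (hκ0 _), Real.mul_rpow hu0 (varpi_pos hW0 _).le, interpolatedCost,
      weightedDiscreteCost, discreteCost_of_ne hxy, one_mul]
    ring
  have hlam0 : 0 < max (s ^ ι * (1 + c / b) ^ (1 - ι)) (t ^ (1 - ι)) :=
    lt_max_of_lt_right (Real.rpow_pos_of_pos ht0 _)
  have hlam1 : max (s ^ ι * (1 + c / b) ^ (1 - ι)) (t ^ (1 - ι)) < 1 :=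
    max_lt hsb (Real.rpow_lt_one ht0.le ht1 (by linarith))
  have hC : 0 < 1 + b / δ := by positivity
  refine exponentialDecay_of_contraction hfl hf0 P hlam0 hlam1 (fun x y ↦ ?_) one_pos
    (Real.rpow_pos_of_pos hC (1 - ι)) (fun z ↦ ?_) (fun z ↦ ?_)
  · by_cases hxy : x = y
    · subst hxy
      exact exists_coupling_self hfl.measurable hself _ _
    have hκxy : 0 < κ (x, y) :=
      (hκ0 _).lt_of_ne' fun h ↦ hxy ((hκ.eq_zero_iff x y).1 h)
    have hvarpi := varpi_pos hV0 (x, y)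
    have key {γ : Measure (S × S)} (hγ : γ ∈ couplings (P x) (P y)) (w u : ℝ) (hw0 : 0 ≤ w)
        (hu0 : 0 ≤ u)
        (hγκ : ∫⁻ z, ENNReal.ofReal (κ z) ∂γ ≤ ENNReal.ofReal (w * κ (x, y)))
        (hu : ε * varpi V (x, y) + 2 * c + 2 * b ≤ u * varpi W (x, y)) :
        ∫⁻ z, ENNReal.ofReal (interpolatedCost W κ ι z) ∂γ
          ≤ ENNReal.ofReal (w ^ ι * u ^ (1 - ι) * interpolatedCost W κ ι (x, y)) := by
      rw [← hpow w hw0 u hu0 x y hxy]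
      exact lintegral_interpolatedCost_le hWl.measurable hW0 hκ.lowerSemicontinuous.measurable hκ0
        hι0 hι1 (mul_nonneg hw0 (hκ0 _)) (mul_nonneg hu0 (varpi_pos hW0 _).le) hγκ
        ((lintegral_varpi_add_const_le hVl.measurable hV0 hε0 hc hdrift hγ hb.le).trans
          (ENNReal.ofReal_le_ofReal hu))
    rcases le_total (varpi V (x, y)) r with hr | hr
    · obtain ⟨γ, hγ, hγκ⟩ := hs x y hκxy hr
      refine ⟨γ, hγ, (key hγ s (1 + c / b) hs0.le (by positivity) hγκ ?_).trans
        (ENNReal.ofReal_le_ofReal (mul_le_mul_of_nonneg_right (le_max_left _ _) (hf0 _)))⟩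
      rw [hW, varpi_add_const]
      have h1 : c / b * (2 * b) = 2 * c := by field_simp
      have h2 : 0 ≤ c / b * varpi V (x, y) := by positivity
      nlinarith
    -- Local contraction is used at the level of the pair itself. Its rate is not uniform, so only
    -- non-expansion of `κ` is kept.
    · obtain ⟨s', -, hs'1, hs'⟩ := hcoup (varpi V (x, y)) (hrr₀.trans hr)
      obtain ⟨γ, hγ, hγκ⟩ := hs' x y hκxy le_rfl
      refine ⟨γ, hγ, (key hγ 1 t zero_le_one ht0.le (hγκ.trans (ENNReal.ofReal_le_ofReal
        (mul_le_mul_of_nonneg_right hs'1.le hκxy.le))) ?_).trans (ENNReal.ofReal_le_ofReal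
          (mul_le_mul_of_nonneg_right ?_ (hf0 _)))⟩
      · rw [hW, varpi_add_const]
        exact ht _ hr
      · rw [Real.one_rpow, one_mul]
        exact le_max_right _ _
  · rw [one_mul]
    exact mul_le_mul_of_nonneg_left (Real.rpow_le_rpow (weightedDiscreteCost_nonneg hV0 z)
      (weightedDiscreteCost_le_add_const V hb.le z) hι') (Real.rpow_nonneg (hκ0 z) _)
  · simp only [interpolatedCost]
    rw [mul_left_comm, ← Real.mul_rpow hC.le (weightedDiscreteCost_nonneg hV0 z)]
    exact mul_le_mul_of_nonneg_left (Real.rpow_le_rpow (weightedDiscreteCost_nonneg hW0 z)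
      (weightedDiscreteCost_add_const_le hδ hVδ hb.le z) hι') (Real.rpow_nonneg (hκ0 z) _)

/-- Harris' theorem in its weighted total variation form, for any cost equivalent to the weighted
discrete cost. -/
theorem exponentialDecay_of_discrete_localContraction {V : S → ℝ} (hV : IsWeight V)
    {P : Kernel S S} [IsMarkovKernel P] (hdrift : DriftCondition V P)
    (hloc : LocalContraction V discreteCost P) {φ : S × S → ℝ} {A : ℝ} (hA : 0 < A)
    (hφ : ∀ z, φ z ≤ A * weightedDiscreteCost V z) (hφ' : ∀ z, weightedDiscreteCost V z ≤ φ z) :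
    ExponentialDecay V φ P := by
  obtain ⟨hVl, δ, hδ, hVδ⟩ := hV
  obtain ⟨ε, c, hε0, hε1, hc, hdrift⟩ := hdrift
  have hV0 (x : S) : 0 < V x := hδ.trans_le (hVδ x)
  obtain ⟨r₀, hr₀, hcoup⟩ := exists_local_coupling hloc
  obtain ⟨r, hrr₀, hrc⟩ : ∃ r, r₀ ≤ r ∧ 4 * c ≤ (1 - ε) * r := by
    refine ⟨max r₀ (4 * c / (1 - ε)), le_max_left _ _, ?_⟩
    rw [← div_le_iff₀' (by linarith)]
    exact le_max_right _ _
  obtain ⟨s, hs0, hs1, hs⟩ := hcoup r hrr₀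
  -- This gives `2c + 2bs ≤ 2b (1 + s) / 2`: half of the contraction of the discrete part pays for
  -- the drift constant.
  obtain ⟨b, hb, hsb⟩ : ∃ b : ℝ, 0 < b ∧ 2 * c ≤ (1 - s) * b := by
    refine ⟨2 * c / (1 - s) + 1, ?_, ?_⟩
    · have : 0 < 1 - s := by linarith
      positivity
    rw [mul_add, mul_div_cancel₀ _ (by linarith : 1 - s ≠ 0)]
    linarith
  obtain ⟨t, ht0, ht1, ht⟩ := exists_drift_ratio hε1 hb (hr₀.trans_le hrr₀) hrc hε0
  set W : S → ℝ := fun x ↦ V x + b with hW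
  have hW0 (x : S) : 0 < W x := add_pos (hV0 x) hb
  have hWl : LowerSemicontinuous W := hVl.add lowerSemicontinuous_const
  have hf0 := weightedDiscreteCost_nonneg hW0
  have hfl := lowerSemicontinuous_weightedDiscreteCost hWl hW0
  have hC : 0 < 1 + b / δ := by positivity
  refine exponentialDecay_of_contraction (lam := max (max ε ((1 + s) / 2)) t) (A := A)
    (B := 1 + b / δ) hfl hf0 P
    (lt_max_of_lt_right ht0) (max_lt (max_lt hε1 (by linarith)) ht1) (fun x y ↦ ?_) hA hC
    (fun z ↦ (hφ z).trans (mul_le_mul_of_nonneg_left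
      (weightedDiscreteCost_le_add_const V hb.le z) hA.le))
    (fun z ↦ (weightedDiscreteCost_add_const_le hδ hVδ hb.le z).trans
      (mul_le_mul_of_nonneg_left (hφ' z) hC.le))
  by_cases hxy : x = y
  · subst hxy
    refine exists_coupling_self hfl.measurable (fun x ↦ ?_) _ _
    rw [weightedDiscreteCost, discreteCost_self, zero_mul]
  have hκxy : discreteCost (x, y) = 1 := discreteCost_of_ne hxy
  have hfxy : weightedDiscreteCost W (x, y) = varpi V (x, y) + 2 * b := by
    rw [weightedDiscreteCost, hκxy, one_mul, hW, varpi_add_const]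
  have hvarpi := varpi_pos hV0 (x, y)
  rw [hfxy]
  rcases le_total (varpi V (x, y)) r with hr | hr
  · obtain ⟨γ, hγ, hγκ⟩ := hs x y (by rw [hκxy]; exact one_pos) hr
    refine ⟨γ, hγ, ?_⟩
    have hdm : Measurable (discreteCost (S := S)) := lowerSemicontinuous_discreteCost.measurable
    -- Here `φ_W = φ_V + 2bφ₀ ≤ ϖ_V + 2bφ₀`; drift controls the first term, local contraction the
    -- second.
    calc ∫⁻ z, ENNReal.ofReal (weightedDiscreteCost W z) ∂γ
        ≤ ∫⁻ z, (ENNReal.ofReal (varpi V z)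
            + ENNReal.ofReal (2 * b) * ENNReal.ofReal (discreteCost z)) ∂γ := by
          refine lintegral_mono fun z ↦ ?_
          rw [← ENNReal.ofReal_mul (by positivity), ← ENNReal.ofReal_add (varpi_pos hV0 z).le
            (mul_nonneg (by positivity) (discreteCost_nonneg z))]
          refine ENNReal.ofReal_le_ofReal ?_
          have h := weightedDiscreteCost_le_varpi hV0 z
          simp only [weightedDiscreteCost, hW, varpi_add_const] at h ⊢
          linarith
      _ = ∫⁻ z, ENNReal.ofReal (varpi V z) ∂γ
            + ENNReal.ofReal (2 * b) * ∫⁻ z, ENNReal.ofReal (discreteCost z) ∂γ := by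
          rw [lintegral_add_right _ (hdm.ennreal_ofReal.const_mul _),
            lintegral_const_mul _ hdm.ennreal_ofReal]
      _ ≤ ENNReal.ofReal (ε * varpi V (x, y) + 2 * c)
            + ENNReal.ofReal (2 * b) * ENNReal.ofReal s := by
          rw [hκxy, mul_one] at hγκ
          exact add_le_add (lintegral_varpi_le hVl.measurable hV0 hε0 hc hdrift hγ)
            (mul_le_mul_right hγκ _)
      _ = ENNReal.ofReal (ε * varpi V (x, y) + 2 * c + 2 * b * s) := by
          rw [← ENNReal.ofReal_mul (by positivity), ← ENNReal.ofReal_add (by positivity)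
            (by positivity)]
      _ ≤ _ := by
          refine ENNReal.ofReal_le_ofReal ?_
          have h1 : ε ≤ max (max ε ((1 + s) / 2)) t := (le_max_left _ _).trans (le_max_left _ _)
          have h2 : (1 + s) / 2 ≤ max (max ε ((1 + s) / 2)) t :=
            (le_max_right _ _).trans (le_max_left _ _)
          have h1' := mul_le_mul_of_nonneg_right h1 hvarpi.le
          have h2' := mul_le_mul_of_nonneg_right h2 (by positivity : 0 ≤ 2 * b)
          rw [mul_add]
          linarith
  -- Any coupling would do: far out, drift alone bounds the cost through `ϖ_W`.
  · obtain ⟨s', -, -, hs'⟩ := hcoup (varpi V (x, y)) (hrr₀.trans hr)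
    obtain ⟨γ, hγ, -⟩ := hs' x y (by rw [hκxy]; exact one_pos) le_rfl
    refine ⟨γ, hγ, ?_⟩
    calc ∫⁻ z, ENNReal.ofReal (weightedDiscreteCost W z) ∂γ
        ≤ ∫⁻ z, ENNReal.ofReal (varpi W z) ∂γ :=
          lintegral_mono fun z ↦ ENNReal.ofReal_le_ofReal (weightedDiscreteCost_le_varpi hW0 z)
      _ ≤ ENNReal.ofReal (ε * varpi V (x, y) + 2 * c + 2 * b) :=
          lintegral_varpi_add_const_le hVl.measurable hV0 hε0 hc hdrift hγ hb.le
      _ ≤ _ := ENNReal.ofReal_le_ofReal ((ht _ hr).trans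
          (mul_le_mul_of_nonneg_right (le_max_right _ _) (by positivity)))

/-- On the diagonal `φ` vanishes; off it `φ_V = ϖ_V`, so boundedness of `φ / ϖ_V` is domination by
`φ_V`. Hence `φ + φ_V` is equivalent to `φ_V`. -/
lemma augmentedCost_le {S : Type*} [TopologicalSpace S] {V : S → ℝ} (hV0 : ∀ x, 0 < V x)
    {φ : S × S → ℝ} (hφ : IsVSemiDistance V φ) :
    ∃ A : ℝ, 0 < A ∧ ∀ z, augmentedCost V φ z ≤ A * weightedDiscreteCost V z := by
  obtain ⟨C, hC⟩ := hφ.bounded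
  refine ⟨max C 0 + 1, by positivity, fun z ↦ ?_⟩
  suffices h : φ z ≤ max C 0 * weightedDiscreteCost V z by
    rw [augmentedCost, add_mul, one_mul]
    linarith
  by_cases hz : z.1 = z.2
  · rw [show φ z = 0 from (hφ.eq_zero_iff z.1 z.2).2 hz]
    exact mul_nonneg (le_max_right _ _) (weightedDiscreteCost_nonneg hV0 z)
  · rw [weightedDiscreteCost, show discreteCost z = 1 from discreteCost_of_ne hz, one_mul]
    have h := (le_abs_self _).trans (hC z)
    rw [div_le_iff₀ (varpi_pos hV0 z)] at h
    exact h.trans (mul_le_mul_of_nonneg_right (le_max_left _ _) (varpi_pos hV0 z).le)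

end Main

end KantorovichContraction

theorem mainTheorem3 {S : Type*} [MetricSpace S] [CompleteSpace S]
    [TopologicalSpace.SeparableSpace S] [MeasurableSpace S] [BorelSpace S]
    (V : S → ℝ) (hV : KantorovichContraction.IsWeight V)
    (P : ProbabilityTheory.Kernel S S) [ProbabilityTheory.IsMarkovKernel P]
    (hdrift : KantorovichContraction.DriftCondition V P) :
    (∀ κ : S × S → ℝ, KantorovichContraction.IsVSemiDistance V κ →
      KantorovichContraction.LocalContraction V κ P →
      ∀ ι : ℝ, 1 / 2 ≤ ι → ι < 1 →
        KantorovichContraction.ExponentialDecay V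
          (KantorovichContraction.interpolatedCost V κ ι) P) ∧
    (KantorovichContraction.LocalContraction V KantorovichContraction.discreteCost P →
      KantorovichContraction.ExponentialDecay V
        (KantorovichContraction.weightedDiscreteCost V) P ∧
      ∀ φ : S × S → ℝ, KantorovichContraction.IsVSemiDistance V φ →
        KantorovichContraction.ExponentialDecay V
          (KantorovichContraction.augmentedCost V φ) P) := by
  have : SecondCountableTopology S := UniformSpace.secondCountable_of_separable S
  refine ⟨fun κ hκ hloc ι hι hι1 ↦ KantorovichContraction.exponentialDecay_interpolatedCost hV
    hdrift hκ.toIsSemiDistance hloc (by linarith) hι1, fun hloc ↦ ⟨?_, fun φ hφ ↦ ?_⟩⟩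
  · exact KantorovichContraction.exponentialDecay_of_discrete_localContraction hV hdrift hloc
      one_pos (fun z ↦ (one_mul _).ge) fun z ↦ le_rfl
  · have hV0 (x : S) : 0 < V x := by
      obtain ⟨δ, hδ, h⟩ := hV.bounded_away
      exact hδ.trans_le (h x)
    obtain ⟨A, hA, hle⟩ := KantorovichContraction.augmentedCost_le hV0 hφ
    refine KantorovichContraction.exponentialDecay_of_discrete_localContraction hV hdrift hloc
      hA hle fun z ↦ ?_
    exact le_add_of_nonneg_left (hφ.nonneg z.1 z.2)
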